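/- Let $\mu$ be a Borel probability measure on $\mathbb{R}$ and let $\rho\ge 1$ be a real number. For Borel probability measures $\nu,\eta$ on $\mathbb{R}$, let $$\mathcal{W}_\rho(\nu,\eta)=\left(\inf_{\pi}\int_{\mathbb{R}\times\mathbb{R}}|x-y|^\rho\,\pi(dx,dy)\right)^{1/\rho}\in[0,+\infty]$$ denote the Wasserstein distance with index $\rho$, where the infimum runs over all measures $\pi$ on $\mathbb{R}\times\mathbb{R}$ with first marginal $\nu$ and second marginal $\eta$. For each integer $N\ge 1$, let $$e_N(\mu,\rho)=\inf\left\{\mathcal{W}_\rho\left(\frac1N\sum_{i=1}^N\delta_{x_i},\mu\right):-\infty<x_1\le x_2\le\cdots\le x_N<+\infty\right\}\in[0,+\infty].$$ Then $$\int_{\mathbb{R}}|x|^\rho\,\mu(dx)<+\infty\quad\Longleftrightarrow\quad\lim_{N\to+\infty}e_N(\mu,\rho)=0.$$ -/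

import Mathlib

open MeasureTheory Filter
open scoped ENNReal Topology

noncomputable section

/-- `π` is a coupling of `ν` and `η`: its two marginals are `ν` and `η`. -/
def IsCoupling (π : Measure (ℝ × ℝ)) (ν η : Measure ℝ) : Prop :=
  π.map Prod.fst = ν ∧ π.map Prod.snd = η

/-- The Wasserstein distance with index `ρ` between measures on the real line,
`(inf_π ∫ |x - y| ^ ρ dπ) ^ (1 / ρ)`, the infimum being over all couplings,
with values in `[0, ∞]`. -/
def wasserstein (ρ : ℝ) (ν η : Measure ℝ) : ℝ≥0∞ :=
  (⨅ (π : Measure (ℝ × ℝ)) (_ : IsCoupling π ν η),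
    ∫⁻ p, ENNReal.ofReal (|p.1 - p.2| ^ ρ) ∂π) ^ (1 / ρ)

/-- The equal-weight empirical measure `(1 / N) ∑ δ_{x_i}` (meant for `N ≥ 1`). -/
def empiricalMeasure {N : ℕ} (x : Fin N → ℝ) : Measure ℝ :=
  (N : ℝ≥0∞)⁻¹ • ∑ i, Measure.dirac (x i)

/-- The minimal error `e_N(μ, ρ)`, the infimum of the Wasserstein distance between `μ` and the
empirical measures of `N` points `x_1 ≤ ⋯ ≤ x_N`, with values in `[0, ∞]` (meant for `N ≥ 1`). -/
def minimalError (N : ℕ) (μ : Measure ℝ) (ρ : ℝ) : ℝ≥0∞ :=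
  ⨅ (x : Fin N → ℝ) (_ : Monotone x), wasserstein ρ (empiricalMeasure x) μ

end

open scoped unitInterval

/-! Write `μ` as the law of some `Q` on `[0, 1]` with Lebesgue measure; a finite moment means `Q ∈
L^ρ`. Approximate `Q` in `L^ρ` by a continuous `g`, and `g` uniformly by its step function on `N`
equal cells. The law of that step function is an empirical measure (`map_comp_unitCell`), and the
joint law with `Q` bounds the distance (`wasserstein_map_le`). Conversely, one finite `e_N` with `N
≥ 1` suffices: some coupling of finite cost transfers the moment from an empirical measure to `μ`.
-/

lemma lintegral_abs_rpow_root_eq_eLpNorm {Ω : Type*} [MeasurableSpace Ω] (P : Measure Ω)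
    (f : Ω → ℝ) {ρ : ℝ} (hρ : 0 < ρ) :
    (∫⁻ ω, ENNReal.ofReal (|f ω| ^ ρ) ∂P) ^ (1 / ρ) = eLpNorm f (ENNReal.ofReal ρ) P := by
  rw [eLpNorm_eq_lintegral_rpow_enorm_toReal (by simpa using hρ) ENNReal.ofReal_ne_top,
    ENNReal.toReal_ofReal hρ.le]
  simp_rw [Real.enorm_eq_ofReal_abs, ENNReal.ofReal_rpow_of_nonneg (abs_nonneg _) hρ.le]

lemma wasserstein_map_le {Ω : Type*} [MeasurableSpace Ω] (P : Measure Ω) {X Y : Ω → ℝ}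
    (hX : Measurable X) (hY : Measurable Y) {ρ : ℝ} (hρ : 0 < ρ) :
    wasserstein ρ (P.map X) (P.map Y) ≤ eLpNorm (X - Y) (ENNReal.ofReal ρ) P := by
  rw [← lintegral_abs_rpow_root_eq_eLpNorm P _ hρ]
  unfold wasserstein
  refine ENNReal.rpow_le_rpow ?_ (by positivity)
  have hXY : Measurable fun ω => (X ω, Y ω) := hX.prodMk hY
  have hc : IsCoupling (P.map fun ω => (X ω, Y ω)) (P.map X) (P.map Y) :=
    ⟨by rw [Measure.map_map measurable_fst hXY]; rfl,
      by rw [Measure.map_map measurable_snd hXY]; rfl⟩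
  refine (iInf₂_le (P.map fun ω => (X ω, Y ω)) hc).trans_eq ?_
  rw [lintegral_map (by fun_prop) hXY]; rfl

lemma empiricalMeasure_comp_perm {N : ℕ} (x : Fin N → ℝ) (s : Equiv.Perm (Fin N)) :
    empiricalMeasure (x ∘ s) = empiricalMeasure x := by
  unfold empiricalMeasure
  congr 1
  exact Equiv.sum_comp s fun i => Measure.dirac (x i)

/-- Sorting the points leaves the empirical measure unchanged, so the order constraint costs
nothing. -/
lemma minimalError_le_wasserstein {N : ℕ} (x : Fin N → ℝ) (μ : Measure ℝ) (ρ : ℝ) :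
    minimalError N μ ρ ≤ wasserstein ρ (empiricalMeasure x) μ := by
  rw [← empiricalMeasure_comp_perm x (Tuple.sort x)]
  exact iInf₂_le _ (Tuple.monotone_sort x)

/-- The index of the cell of the partition of `[0, 1]` into `n + 1` equal intervals that
contains a given point. -/
noncomputable def unitCell (n : ℕ) (u : I) : Fin (n + 1) :=
  ⟨min ⌊((n : ℝ) + 1) * u⌋₊ n, by omega⟩

lemma measurable_unitCell (n : ℕ) : Measurable (unitCell n) := by
  have h : Measurable fun u : I => min ⌊((n : ℝ) + 1) * u⌋₊ n :=
    (Nat.measurable_floor.comp (measurable_subtype_coe.const_mul _)).min measurable_const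
  refine measurable_to_countable' fun i => ?_
  convert! h (measurableSet_singleton (i : ℕ)) using 1
  ext u
  simp [unitCell, Fin.ext_iff]

lemma unitCell_le (n : ℕ) (u : I) : (unitCell n u : ℝ) / (n + 1) ≤ u := by
  rw [div_le_iff₀ (by positivity), mul_comm]
  refine le_trans ?_ (Nat.floor_le (mul_nonneg (by positivity) u.2.1))
  simp only [unitCell, Nat.cast_min]
  exact min_le_left _ _

lemma le_unitCell_add_one (n : ℕ) (u : I) : (u : ℝ) ≤ ((unitCell n u : ℝ) + 1) / (n + 1) := by
  rw [le_div_iff₀ (by positivity), mul_comm]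
  have h1 := Nat.lt_floor_add_one (((n : ℝ) + 1) * u)
  -- Serves the case where the minimum is `n`; the cap changes the floor only at `u = 1`.
  have h2 : ((n : ℝ) + 1) * u ≤ n + 1 := mul_le_of_le_one_right (by positivity) u.2.2
  simp only [unitCell, Nat.cast_min]
  rcases min_choice ((⌊((n : ℝ) + 1) * u⌋₊ : ℝ)) n with h | h <;> rw [h] <;> linarith

lemma fin_div_mem_unitInterval {n k : ℕ} (hk : k ≤ n + 1) : (k : ℝ) / (n + 1) ∈ I :=
  ⟨by positivity, div_le_one_of_le₀ (by exact_mod_cast hk) (by positivity)⟩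

/-- The cell lies between the open and the closed interval with the same endpoints, so its boundary
points need no care. -/
lemma volume_unitCell_preimage (n : ℕ) (i : Fin (n + 1)) :
    volume (unitCell n ⁻¹' {i}) = ((n + 1 : ℕ) : ℝ≥0∞)⁻¹ := by
  let a : I := ⟨_, fin_div_mem_unitInterval i.2.le⟩
  let b : I := ⟨_, fin_div_mem_unitInterval (Nat.succ_le_of_lt i.2)⟩
  have hab : ENNReal.ofReal ((b : ℝ) - a) = ((n + 1 : ℕ) : ℝ≥0∞)⁻¹ := by
    have : (b : ℝ) - a = ((n + 1 : ℕ) : ℝ)⁻¹ := by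
      simp only [a, b]; push_cast; field_simp; ring
    rw [this, ENNReal.ofReal_inv_of_pos (by positivity), ENNReal.ofReal_natCast]
  apply le_antisymm
  · rw [← hab, ← unitInterval.volume_Icc]
    refine measure_mono fun u hu => ?_
    obtain rfl : unitCell n u = i := hu
    refine ⟨unitCell_le n u, Subtype.coe_le_coe.1 ?_⟩
    simpa [b] using le_unitCell_add_one n u
  · rw [← hab, ← unitInterval.volume_Ioo]
    refine measure_mono fun u hu => ?_
    have h1 : ((i : ℕ) : ℝ) / (n + 1) < u := hu.1
    have h2 : (u : ℝ) < ((i + 1 : ℕ) : ℝ) / (n + 1) := hu.2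
    have h3 := h1.trans_le (le_unitCell_add_one n u)
    have h4 := (unitCell_le n u).trans_lt h2
    rw [div_lt_div_iff_of_pos_right (by positivity)] at h3 h4
    norm_cast at h3 h4
    exact Fin.ext (by omega)

lemma map_comp_unitCell {n : ℕ} (x : Fin (n + 1) → ℝ) :
    (volume : Measure I).map (x ∘ unitCell n) = empiricalMeasure x := by
  rw [← Measure.map_map (measurable_of_finite x) (measurable_unitCell n),
    Measure.map_eq_sum _ _ (measurable_unitCell n), Measure.sum_fintype]
  simp_rw [volume_unitCell_preimage, ← Finset.smul_sum]
  rw [Measure.map_smul, empiricalMeasure,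
    ← Measure.mapₗ_apply_of_measurable (measurable_of_finite x), map_sum]
  simp [Measure.mapₗ_apply_of_measurable (measurable_of_finite x)]

lemma tendsto_minimalError_of_moment_lt_top (μ : Measure ℝ) [IsProbabilityMeasure μ] {ρ : ℝ}
    (hρ : 1 ≤ ρ) (hμ : (∫⁻ x, ENNReal.ofReal (|x| ^ ρ) ∂μ) < ∞) :
    Tendsto (fun N : ℕ => minimalError N μ ρ) atTop (𝓝 0) := by
  have hρ0 : 0 < ρ := by linarith
  obtain ⟨Q, hQ, hQμ⟩ := μ.exists_measurable_map_eq
  have hQL : MemLp Q (ENNReal.ofReal ρ) volume := by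
    refine ⟨hQ.aestronglyMeasurable, ?_⟩
    rw [← lintegral_abs_rpow_root_eq_eLpNorm _ _ hρ0]
    rw [← hQμ, lintegral_map (by fun_prop) hQ] at hμ
    exact ENNReal.rpow_lt_top_of_nonneg (by positivity) hμ.ne
  rw [ENNReal.tendsto_nhds_zero]
  intro ε hε
  obtain ⟨δ, hδ, hδε⟩ : ∃ δ : ℝ, 0 < δ ∧ ENNReal.ofReal δ ≤ ε / 2 := by
    obtain ⟨δ, hδ, h⟩ := ENNReal.lt_iff_exists_nnreal_btwn.1 (ENNReal.half_pos hε.ne')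
    exact ⟨δ, by simpa using hδ, by simpa using h.le⟩
  obtain ⟨g, hg, -⟩ := hQL.exists_boundedContinuous_eLpNorm_sub_le ENNReal.ofReal_ne_top
    (ENNReal.half_pos hε.ne').ne'
  obtain ⟨η, hη, hgη⟩ := Metric.uniformContinuous_iff.1
    (CompactSpace.uniformContinuous_of_continuous g.continuous) δ hδ
  obtain ⟨n₀, hn₀⟩ := exists_nat_one_div_lt hη
  filter_upwards [eventually_ge_atTop (n₀ + 1)] with N hN
  obtain ⟨n, rfl⟩ : ∃ n, N = n + 1 := ⟨N - 1, by omega⟩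
  let x : Fin (n + 1) → ℝ := fun i => g ⟨_, fin_div_mem_unitInterval i.2.le⟩
  have hx : Measurable (x ∘ unitCell n) := (measurable_of_finite x).comp (measurable_unitCell n)
  refine (minimalError_le_wasserstein x μ ρ).trans ?_
  rw [← map_comp_unitCell, ← hQμ]
  refine (wasserstein_map_le _ hx hQ hρ0).trans ?_
  have hstep : eLpNorm (x ∘ unitCell n - ⇑g) (ENNReal.ofReal ρ) volume ≤ ε / 2 := by
    -- On a probability space the sup norm dominates the `L^ρ` norm.
    refine (eLpNorm_le_of_ae_bound (C := δ) (ae_of_all _ fun u => ?_)).trans (by simpa using hδε)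
    rw [Pi.sub_apply, ← dist_eq_norm]
    refine (hgη ?_).le
    have h1 := unitCell_le n u
    have h2 := le_unitCell_add_one n u
    have h3 : (1 : ℝ) / (n + 1) ≤ 1 / (n₀ + 1) :=
      Nat.one_div_le_one_div (by omega)
    rw [add_div] at h2
    rw [Subtype.dist_eq, Real.dist_eq, abs_lt]
    constructor <;> dsimp only <;> linarith
  calc eLpNorm (x ∘ unitCell n - Q) (ENNReal.ofReal ρ) volume
      = eLpNorm ((x ∘ unitCell n - ⇑g) + (⇑g - Q)) (ENNReal.ofReal ρ) volume := by
        rw [sub_add_sub_cancel]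
    _ ≤ eLpNorm (x ∘ unitCell n - ⇑g) (ENNReal.ofReal ρ) volume
        + eLpNorm (⇑g - Q) (ENNReal.ofReal ρ) volume :=
        eLpNorm_add_le (hx.sub g.continuous.measurable).aestronglyMeasurable
          (g.continuous.measurable.sub hQ).aestronglyMeasurable (by simpa using hρ)
    _ ≤ ε / 2 + ε / 2 := add_le_add hstep (by rwa [eLpNorm_sub_comm])
    _ = ε := ENNReal.add_halves ε

/-- Integrate `|y|^ρ ≤ 2^(ρ-1) (|x|^ρ + |x-y|^ρ)`, from convexity of `t^ρ`, against a coupling of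
finite cost. -/
lemma moment_lt_top_of_wasserstein_lt_top {ν μ : Measure ℝ} {ρ : ℝ} (hρ : 1 ≤ ρ)
    (hν : (∫⁻ x, ENNReal.ofReal (|x| ^ ρ) ∂ν) < ∞) (h : wasserstein ρ ν μ < ∞) :
    (∫⁻ x, ENNReal.ofReal (|x| ^ ρ) ∂μ) < ∞ := by
  have hρ0 : 0 < ρ := by linarith
  rw [wasserstein, ENNReal.rpow_lt_top_iff_of_pos (by positivity)] at h
  simp only [iInf_lt_iff] at h
  obtain ⟨π, ⟨rfl, rfl⟩, hπ⟩ := h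
  rw [lintegral_map (by fun_prop) measurable_fst] at hν
  rw [lintegral_map (by fun_prop) measurable_snd]
  calc ∫⁻ p, ENNReal.ofReal (|p.2| ^ ρ) ∂π
      ≤ ∫⁻ p, 2 ^ (ρ - 1) * (ENNReal.ofReal (|p.1| ^ ρ) + ENNReal.ofReal (|p.1 - p.2| ^ ρ)) ∂π := by
        refine lintegral_mono fun p => ?_
        simp only [← ENNReal.ofReal_rpow_of_nonneg (abs_nonneg _) hρ0.le]
        refine le_trans ?_ (ENNReal.rpow_add_le_mul_rpow_add_rpow _ _ hρ)
        refine ENNReal.rpow_le_rpow ?_ hρ0.le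
        rw [← ENNReal.ofReal_add (abs_nonneg _) (abs_nonneg _)]
        refine ENNReal.ofReal_le_ofReal ?_
        simpa using abs_sub p.1 (p.1 - p.2)
    _ = 2 ^ (ρ - 1) * (∫⁻ p, ENNReal.ofReal (|p.1| ^ ρ) ∂π
          + ∫⁻ p, ENNReal.ofReal (|p.1 - p.2| ^ ρ) ∂π) := by
        rw [lintegral_const_mul _ (by fun_prop), lintegral_add_left (by fun_prop)]
    _ < ∞ := ENNReal.mul_lt_top
        (ENNReal.rpow_lt_top_of_nonneg (by linarith) ENNReal.ofNat_ne_top)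
        (ENNReal.add_lt_top.2 ⟨hν, hπ⟩)

lemma empiricalMeasure_moment_lt_top {N : ℕ} (hN : N ≠ 0) (x : Fin N → ℝ) (ρ : ℝ) :
    (∫⁻ y, ENNReal.ofReal (|y| ^ ρ) ∂(empiricalMeasure x)) < ∞ := by
  rw [empiricalMeasure, lintegral_smul_measure, lintegral_finsetSum_measure, smul_eq_mul]
  refine ENNReal.mul_lt_top (by simpa [pos_iff_ne_zero] using hN) (ENNReal.sum_lt_top.2 fun i _ => ?_)
  simp

theorem mainTheorem7 (μ : Measure ℝ) [IsProbabilityMeasure μ] (ρ : ℝ) (hρ : 1 ≤ ρ) :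
    (∫⁻ x, ENNReal.ofReal (|x| ^ ρ) ∂μ) < ∞ ↔
      Tendsto (fun N : ℕ => minimalError N μ ρ) atTop (𝓝 0) := by
  refine ⟨tendsto_minimalError_of_moment_lt_top μ hρ, fun h => ?_⟩
  obtain ⟨N, hN, hN0⟩ :=
    ((h.eventually_lt_const ENNReal.zero_lt_top).and (eventually_ne_atTop 0)).exists
  simp only [minimalError, iInf_lt_iff] at hN
  obtain ⟨x, -, hx⟩ := hN
  exact moment_lt_top_of_wasserstein_lt_top hρ (empiricalMeasure_moment_lt_top hN0 x ρ) hx
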